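/- Let $\mathbb{T}=\mathbb{R}/2\pi\mathbb{Z}$, and let $L^1(\mathbb{T})$ be the complex Banach space of integrable functions on $\mathbb{T}$ with the norm $\|f\|_{L^1(\mathbb{T})}=\frac{1}{2\pi}\int_{-\pi}^{\pi}|f(s)|\,ds$. A complex Banach space $X$ with norm $\|\cdot\|$ is called homogeneous if it is a linear subspace of $L^1(\mathbb{T})$ and (H$_1$) $\|f\|_{L^1(\mathbb{T})}\le\|f\|$ for all $f\in X$; (H$_2$) $f(\cdot+a)\in X$ and $\|f(\cdot+a)\|=\|f\|$ for all $f\in X$ and $a\in\mathbb{T}$; (H$_3$) $\|f(\cdot+b)-f(\cdot+a)\|\to0$ as $b\to a$, for all $f\in X$ and $a\in\mathbb{T}$. Let $X_0$ and $X_1$ be homogeneous Banach spaces, with norms $\|\cdot\|_0$ and $\|\cdot\|_1$, and give $X_0+X_1$ the norm $\inf\{\|f_0\|_0+\|f_1\|_1 : f=f_0+f_1,\ f_j\in X_j\}$. For $0<\theta<1$ and $1\le q<\infty$ let $(X_0,X_1)_{\theta,q}$ be the real interpolation space of all $f\in X_0+X_1$ with $$\|f\|_{\theta,q}=\Big(\int_0^\infty\big(t^{-\theta}K(t,f)\big)^q\,\frac{dt}{t}\Big)^{1/q}<\infty,\qquad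 K(t,f)=\inf\{\|f_0\|_0+t\|f_1\|_1 : f=f_0+f_1,\ f_j\in X_j\}.$$ Let $[X_0,X_1]_\theta$ be the complex interpolation space of all values $F(\theta)$, where $F$ runs over the bounded continuous functions from the strip $0\le\operatorname{Re}z\le1$ to $X_0+X_1$ that are holomorphic for $0<\operatorname{Re}z<1$ and for which $\tau\mapsto F(i\tau)$ and $\tau\mapsto F(1+i\tau)$ are bounded continuous functions from $\mathbb{R}$ to $X_0$ and to $X_1$, respectively; its norm is $$\|f\|_{[\theta]}=\inf\Big\{\max\Big(\sup_{\tau\in\mathbb{R}}\|F(i\tau)\|_0,\ \sup_{\tau\in\mathbb{R}}\|F(1+i\tau)\|_1\Big) : F(\theta)=f\Big\}.$$ Then, whenever $0<\theta<1$ and $1\le q<\infty$, each of the spaces $(X_0,X_1)_{\theta,q}$ and $[X_0,X_1]_\theta$ is homogeneous up to equivalence of norms, that is, it has a norm equivalent to its interpolation norm with respect to which it is a homogeneous Banach space. -/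

import Mathlib

open Set Filter Topology MeasureTheory
open scoped Real ENNReal BoundedContinuousFunction

/-! ### Normed spaces that are linear subspaces of a given complex normed space -/

/-- A linear subspace of `E` endowed with a norm of its own (not assumed to be related to the
norm of `E`). -/
structure NormedSubspace (E : Type*) [NormedAddCommGroup E] [NormedSpace ℂ E] where
  /-- the underlying linear subspace -/
  toSubmodule : Submodule ℂ E
  /-- its own norm -/
  seminorm : Seminorm ℂ toSubmodule
  eq_zero_of_seminorm_eq_zero : ∀ f, seminorm f = 0 → f = 0

namespace NormedSubspace

variable {E : Type*} [NormedAddCommGroup E] [NormedSpace ℂ E]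

/-- The subspace as a type that carries its own norm (instead of the norm of `E`). -/
def Space (X : NormedSubspace E) : Type _ := X.toSubmodule

instance (X : NormedSubspace E) : AddCommGroup X.Space :=
  inferInstanceAs (AddCommGroup X.toSubmodule)

instance (X : NormedSubspace E) : Module ℂ X.Space :=
  inferInstanceAs (Module ℂ X.toSubmodule)

noncomputable instance (X : NormedSubspace E) : NormedAddCommGroup X.Space :=
  AddGroupNorm.toNormedAddCommGroup
    { toFun := fun f => X.seminorm f
      map_zero' := map_zero X.seminorm
      add_le' := fun f g => map_add_le_add X.seminorm f g
      neg' := fun f => map_neg_eq_map X.seminorm f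
      eq_zero_of_map_eq_zero' := fun f hf => X.eq_zero_of_seminorm_eq_zero f hf }

noncomputable instance (X : NormedSubspace E) : NormedSpace ℂ X.Space where
  norm_smul_le := fun c f => (map_smul_eq_mul X.seminorm c f).le

/-- The inclusion map into the ambient space. -/
def incl (X : NormedSubspace E) : X.Space →ₗ[ℂ] E := X.toSubmodule.subtype

/-- An element of the subspace, as an element of the normed space `X.Space`. -/
def elt (X : NormedSubspace E) (f : E) (hf : f ∈ X.toSubmodule) : X.Space := ⟨f, hf⟩

theorem incl_mem (X : NormedSubspace E) (f : X.Space) : X.incl f ∈ X.toSubmodule := f.2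

theorem incl_injective (X : NormedSubspace E) : Function.Injective X.incl :=
  Subtype.val_injective

theorem incl_elt (X : NormedSubspace E) (f : E) (hf : f ∈ X.toSubmodule) :
    X.incl (X.elt f hf) = f := rfl

/-- `X` and `Y` coincide as linear spaces and have equivalent norms. -/
def EquivNorm (X Y : NormedSubspace E) : Prop :=
  X.toSubmodule = Y.toSubmodule ∧
    ∃ c C : ℝ, 0 < c ∧ 0 < C ∧ ∀ (f : E) (hX : f ∈ X.toSubmodule) (hY : f ∈ Y.toSubmodule),
      c * ‖X.elt f hX‖ ≤ ‖Y.elt f hY‖ ∧ ‖Y.elt f hY‖ ≤ C * ‖X.elt f hX‖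

end NormedSubspace

/-! ### Interpolation couples and the K-functional -/

/-- An interpolation couple: two Banach spaces that are linear subspaces of `E` and are
continuously embedded in `E`. -/
structure InterpolationCouple (E : Type*) [NormedAddCommGroup E] [NormedSpace ℂ E] where
  X₀ : NormedSubspace E
  X₁ : NormedSubspace E
  complete₀ : CompleteSpace X₀.Space
  complete₁ : CompleteSpace X₁.Space
  continuous₀ : Continuous X₀.incl
  continuous₁ : Continuous X₁.incl

namespace InterpolationCouple

variable {E : Type*} [NormedAddCommGroup E] [NormedSpace ℂ E] (A : InterpolationCouple E)

/-- The decompositions `f = f₀ + f₁` with `f₀ ∈ X₀` and `f₁ ∈ X₁`. -/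
abbrev Decomp (f : E) : Type _ :=
  {p : A.X₀.Space × A.X₁.Space // A.X₀.incl p.1 + A.X₁.incl p.2 = f}

/-- The K-functional: `K(t, f) = inf {‖f₀‖ + t ‖f₁‖ : f = f₀ + f₁}` for `t > 0` and
`f ∈ X₀ + X₁`. -/
noncomputable def K (t : ℝ) (f : E) : ℝ :=
  ⨅ p : A.Decomp f, (‖p.1.1‖ + t * ‖p.1.2‖)

theorem nonempty_decomp {f : E} (hf : f ∈ A.X₀.toSubmodule ⊔ A.X₁.toSubmodule) :
    Nonempty (A.Decomp f) := by
  obtain ⟨y, hy, z, hz, rfl⟩ := Submodule.mem_sup.1 hf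
  exact ⟨⟨(A.X₀.elt y hy, A.X₁.elt z hz), rfl⟩⟩

theorem K_bddBelow {t : ℝ} (ht : 0 ≤ t) (f : E) :
    BddBelow (range fun p : A.Decomp f => ‖p.1.1‖ + t * ‖p.1.2‖) :=
  ⟨0, by rintro _ ⟨p, rfl⟩; positivity⟩

theorem K_nonneg {t : ℝ} (ht : 0 ≤ t) (f : E) : 0 ≤ A.K t f :=
  Real.iInf_nonneg fun p => by positivity

theorem K_add_le {t : ℝ} (ht : 0 ≤ t) {f g : E}
    (hf : f ∈ A.X₀.toSubmodule ⊔ A.X₁.toSubmodule)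
    (hg : g ∈ A.X₀.toSubmodule ⊔ A.X₁.toSubmodule) :
    A.K t (f + g) ≤ A.K t f + A.K t g := by
  have := A.nonempty_decomp hf
  have := A.nonempty_decomp hg
  refine le_ciInf_add_ciInf fun p r => ?_
  refine (ciInf_le (A.K_bddBelow ht (f + g)) ⟨p.1 + r.1, ?_⟩).trans ?_
  · refine Eq.trans ?_ (congrArg₂ (· + ·) p.2 r.2)
    simp only [Prod.fst_add, Prod.snd_add, map_add]
    abel
  · have h0 := norm_add_le p.1.1 r.1.1
    have h1 := mul_le_mul_of_nonneg_left (norm_add_le p.1.2 r.1.2) ht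
    simp only [Prod.fst_add, Prod.snd_add]
    linarith

theorem K_smul_le {t : ℝ} (ht : 0 ≤ t) (c : ℂ) {f : E}
    (hf : f ∈ A.X₀.toSubmodule ⊔ A.X₁.toSubmodule) :
    A.K t (c • f) ≤ ‖c‖ * A.K t f := by
  have := A.nonempty_decomp hf
  rw [K, K, Real.mul_iInf_of_nonneg (norm_nonneg c)]
  refine le_ciInf fun p => ?_
  refine (ciInf_le (A.K_bddBelow ht (c • f)) ⟨c • p.1, ?_⟩).trans ?_
  · refine Eq.trans ?_ (congrArg (c • ·) p.2)
    simp
  · simp only [Prod.smul_fst, Prod.smul_snd, norm_smul]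
    linarith

theorem K_zero {t : ℝ} (ht : 0 ≤ t) : A.K t 0 = 0 := by
  refine le_antisymm ?_ (A.K_nonneg ht 0)
  simpa using A.K_smul_le ht 0 (Submodule.zero_mem _)

theorem K_smul {t : ℝ} (ht : 0 ≤ t) (c : ℂ) {f : E}
    (hf : f ∈ A.X₀.toSubmodule ⊔ A.X₁.toSubmodule) :
    A.K t (c • f) = ‖c‖ * A.K t f := by
  rcases eq_or_ne c 0 with rfl | hc
  · simp [A.K_zero ht]
  refine le_antisymm (A.K_smul_le ht c hf) ?_
  have h := A.K_smul_le ht c⁻¹ (Submodule.smul_mem _ c hf)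
  rw [inv_smul_smul₀ hc, norm_inv] at h
  have hc' : 0 < ‖c‖ := norm_pos_iff.2 hc
  rwa [← div_eq_inv_mul, le_div_iff₀ hc', mul_comm] at h

theorem K_mono {s t : ℝ} (hs : 0 ≤ s) (hst : s ≤ t) {f : E}
    (hf : f ∈ A.X₀.toSubmodule ⊔ A.X₁.toSubmodule) : A.K s f ≤ A.K t f := by
  have := A.nonempty_decomp hf
  exact ciInf_mono (A.K_bddBelow hs f) fun p => by gcongr

theorem exists_norm_le_K {t : ℝ} (ht : 0 < t) :
    ∃ C : ℝ, 0 < C ∧ ∀ f ∈ A.X₀.toSubmodule ⊔ A.X₁.toSubmodule, ‖f‖ ≤ C * A.K t f := by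
  obtain ⟨C₀, h₀, hC₀⟩ :=
    (⟨A.X₀.incl, A.continuous₀⟩ : A.X₀.Space →L[ℂ] E).bound
  obtain ⟨C₁, h₁, hC₁⟩ :=
    (⟨A.X₁.incl, A.continuous₁⟩ : A.X₁.Space →L[ℂ] E).bound
  refine ⟨C₀ + C₁ / t, by positivity, fun f hf => ?_⟩
  have := A.nonempty_decomp hf
  rw [K, Real.mul_iInf_of_nonneg (by positivity)]
  refine le_ciInf fun p => ?_
  have e0 : ‖A.X₀.incl p.1.1‖ ≤ C₀ * ‖p.1.1‖ := hC₀ _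
  have e1 : ‖A.X₁.incl p.1.2‖ ≤ C₁ * ‖p.1.2‖ := hC₁ _
  have e2 : (C₀ + C₁ / t) * (‖p.1.1‖ + t * ‖p.1.2‖)
      = C₀ * ‖p.1.1‖ + C₁ * ‖p.1.2‖ + (C₁ / t * ‖p.1.1‖ + C₀ * (t * ‖p.1.2‖)) := by
    field_simp
    ring
  have e3 : 0 ≤ C₁ / t * ‖p.1.1‖ + C₀ * (t * ‖p.1.2‖) := by positivity
  calc ‖f‖ = ‖A.X₀.incl p.1.1 + A.X₁.incl p.1.2‖ := by rw [p.2]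
    _ ≤ ‖A.X₀.incl p.1.1‖ + ‖A.X₁.incl p.1.2‖ := norm_add_le _ _
    _ ≤ _ := by linarith

theorem eq_zero_of_K_eq_zero {t : ℝ} (ht : 0 < t) {f : E}
    (hf : f ∈ A.X₀.toSubmodule ⊔ A.X₁.toSubmodule) (h : A.K t f = 0) : f = 0 := by
  obtain ⟨C, -, hC⟩ := A.exists_norm_le_K ht
  simpa [h] using hC f hf

/-- The sum `X₀ + X₁` with its norm `inf {‖f₀‖ + ‖f₁‖ : f = f₀ + f₁}`. -/
noncomputable def sum : NormedSubspace E where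
  toSubmodule := A.X₀.toSubmodule ⊔ A.X₁.toSubmodule
  seminorm := Seminorm.of (fun f => A.K 1 f)
    (fun f g => A.K_add_le zero_le_one f.2 g.2)
    (fun c f => A.K_smul zero_le_one c f.2)
  eq_zero_of_seminorm_eq_zero := fun f hf =>
    Subtype.ext (A.eq_zero_of_K_eq_zero one_pos f.2 hf)

/-! ### The real interpolation method -/

/-- The measure `dt / t` on the half-line `(0, ∞)`. -/
noncomputable def dtOverT : Measure ℝ :=
  (volume.restrict (Ioi (0 : ℝ))).withDensity fun t => ENNReal.ofReal (1 / t)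

theorem ae_dtOverT_pos : ∀ᵐ t ∂dtOverT, (0 : ℝ) < t :=
  (withDensity_absolutelyContinuous _ _).ae_le (ae_restrict_mem measurableSet_Ioi)

theorem dtOverT_ne_zero : dtOverT ≠ 0 := by
  intro h
  have hm : Measurable fun t : ℝ => ENNReal.ofReal (1 / t) := by fun_prop
  rw [dtOverT, withDensity_eq_zero_iff hm.aemeasurable] at h
  have h2 : ∀ᵐ t ∂(volume.restrict (Ioi (0 : ℝ))), False := by
    filter_upwards [h, ae_restrict_mem measurableSet_Ioi] with t ht ht0
    have : 0 < 1 / t := one_div_pos.2 ht0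
    simp only [Pi.zero_apply, ENNReal.ofReal_eq_zero] at ht
    linarith
  have h3 := ae_eq_bot.1 (eventually_false_iff_eq_bot.1 h2)
  simp at h3

/-- The (possibly infinite) norm `(∫₀^∞ (t ^ (-θ) K(t, f)) ^ q dt / t) ^ (1 / q)` of the real
method. -/
noncomputable def realNorm (θ : ℝ) (q : ℝ≥0∞) (f : E) : ℝ≥0∞ :=
  eLpNorm (fun t : ℝ => t ^ (-θ) * A.K t f) q dtOverT

theorem aestronglyMeasurable_K (θ : ℝ) {f : E}
    (hf : f ∈ A.X₀.toSubmodule ⊔ A.X₁.toSubmodule) :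
    AEStronglyMeasurable (fun t : ℝ => t ^ (-θ) * A.K t f) dtOverT := by
  have h1 : AEMeasurable (fun t : ℝ => A.K t f) (volume.restrict (Ioi (0 : ℝ))) :=
    aemeasurable_restrict_of_monotoneOn measurableSet_Ioi
      fun s hs t _ hst => A.K_mono (le_of_lt hs) hst hf
  have h2 : AEMeasurable (fun t : ℝ => t ^ (-θ)) (volume.restrict (Ioi (0 : ℝ))) := by
    fun_prop
  exact (h2.mul h1).aestronglyMeasurable.mono_ac (withDensity_absolutelyContinuous _ _)

theorem realNorm_add_le (θ : ℝ) {q : ℝ≥0∞} (hq : 1 ≤ q) {f g : E}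
    (hf : f ∈ A.X₀.toSubmodule ⊔ A.X₁.toSubmodule)
    (hg : g ∈ A.X₀.toSubmodule ⊔ A.X₁.toSubmodule) :
    A.realNorm θ q (f + g) ≤ A.realNorm θ q f + A.realNorm θ q g := by
  refine le_trans ?_ (eLpNorm_add_le (A.aestronglyMeasurable_K θ hf)
    (A.aestronglyMeasurable_K θ hg) hq)
  refine eLpNorm_mono_ae_real ?_
  filter_upwards [ae_dtOverT_pos] with t ht
  have h0 : 0 ≤ t ^ (-θ) := Real.rpow_nonneg ht.le _
  rw [Real.norm_of_nonneg (mul_nonneg h0 (A.K_nonneg ht.le _)), Pi.add_apply, ← mul_add]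
  exact mul_le_mul_of_nonneg_left (A.K_add_le ht.le hf hg) h0

theorem realNorm_smul (θ : ℝ) (q : ℝ≥0∞) (c : ℂ) {f : E}
    (hf : f ∈ A.X₀.toSubmodule ⊔ A.X₁.toSubmodule) :
    A.realNorm θ q (c • f) = ‖c‖ₑ * A.realNorm θ q f := by
  have h : (fun t : ℝ => t ^ (-θ) * A.K t (c • f)) =ᵐ[dtOverT]
      ‖c‖ • fun t : ℝ => t ^ (-θ) * A.K t f := by
    filter_upwards [ae_dtOverT_pos] with t ht
    rw [A.K_smul ht.le c hf, Pi.smul_apply, smul_eq_mul]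
    ring
  rw [realNorm, eLpNorm_congr_ae h, eLpNorm_const_smul, enorm_norm, realNorm]

theorem realNorm_zero (θ : ℝ) (q : ℝ≥0∞) : A.realNorm θ q 0 = 0 := by
  simpa using A.realNorm_smul θ q 0 (Submodule.zero_mem _)

theorem eq_zero_of_realNorm_eq_zero (θ : ℝ) {q : ℝ≥0∞} (hq : 1 ≤ q) {f : E}
    (hf : f ∈ A.X₀.toSubmodule ⊔ A.X₁.toSubmodule) (h : A.realNorm θ q f = 0) : f = 0 := by
  have hq0 : q ≠ 0 := (zero_lt_one.trans_le hq).ne'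
  rw [realNorm, eLpNorm_eq_zero_iff (A.aestronglyMeasurable_K θ hf) hq0] at h
  have : (ae dtOverT).NeBot := ae_neBot.2 dtOverT_ne_zero
  obtain ⟨t, ht, ht0⟩ := (h.and ae_dtOverT_pos).exists
  refine A.eq_zero_of_K_eq_zero ht0 hf ?_
  simpa [(Real.rpow_pos_of_pos ht0 (-θ)).ne'] using ht

/-- The real interpolation space `(X₀, X₁)_{θ,q}`: the elements of `X₀ + X₁` for which the norm
of the K-method is finite. -/
noncomputable def realInterp (θ : ℝ) (q : ℝ≥0∞) (hq : 1 ≤ q) : NormedSubspace E where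
  toSubmodule :=
    { carrier := {f | f ∈ A.X₀.toSubmodule ⊔ A.X₁.toSubmodule ∧ A.realNorm θ q f < ∞}
      zero_mem' := ⟨Submodule.zero_mem _, by simp [A.realNorm_zero θ q]⟩
      add_mem' := fun {f g} hf hg => ⟨Submodule.add_mem _ hf.1 hg.1,
        (A.realNorm_add_le θ hq hf.1 hg.1).trans_lt (ENNReal.add_lt_top.2 ⟨hf.2, hg.2⟩)⟩
      smul_mem' := fun c f hf => ⟨Submodule.smul_mem _ c hf.1, by
        rw [A.realNorm_smul θ q c hf.1]
        exact ENNReal.mul_lt_top enorm_lt_top hf.2⟩ }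
  seminorm := Seminorm.of (fun f => (A.realNorm θ q f).toReal)
    (fun f g => (ENNReal.toReal_mono (ENNReal.add_ne_top.2 ⟨f.2.2.ne, g.2.2.ne⟩)
      (A.realNorm_add_le θ hq f.2.1 g.2.1)).trans_eq
        (ENNReal.toReal_add f.2.2.ne g.2.2.ne))
    (fun c f => by
      have := congrArg ENNReal.toReal (A.realNorm_smul θ q c f.2.1)
      rwa [ENNReal.toReal_mul, toReal_enorm] at this)
  eq_zero_of_seminorm_eq_zero := fun f hf => Subtype.ext <|
    A.eq_zero_of_realNorm_eq_zero θ hq f.2.1 <|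
      ((ENNReal.toReal_eq_zero_iff _).1 hf).resolve_right f.2.2.ne

/-! ### The complex interpolation method -/

/-- The space of admissible functions of the complex method: the bounded functions `F` with
values in `X₀ + X₁`, continuous on the closed strip `0 ≤ Re z ≤ 1` and holomorphic on the open
strip `0 < Re z < 1`, for which `τ ↦ F(iτ)` is a bounded continuous function with values in the
Banach space `X₀` and `τ ↦ F(1 + iτ)` one with values in `X₁`. An element is a triple of `F` and
these two boundary functions. -/
noncomputable def Admissible :
    Submodule ℂ ((ℂ → A.sum.Space) × (ℝ →ᵇ A.X₀.Space) × (ℝ →ᵇ A.X₁.Space)) where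
  carrier := {G | DiffContOnCl ℂ G.1 (Complex.re ⁻¹' Ioo 0 1) ∧
    (∃ M : ℝ, ∀ z : ℂ, z.re ∈ Icc (0 : ℝ) 1 → ‖G.1 z‖ ≤ M) ∧
    (∀ τ : ℝ, A.sum.incl (G.1 (τ * Complex.I)) = A.X₀.incl (G.2.1 τ)) ∧
    (∀ τ : ℝ, A.sum.incl (G.1 (1 + τ * Complex.I)) = A.X₁.incl (G.2.2 τ))}
  zero_mem' := ⟨diffContOnCl_const, ⟨0, fun z _ => by simp⟩, fun τ => by simp, fun τ => by simp⟩
  add_mem' := by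
    rintro F G ⟨h1, ⟨M, h2⟩, h3, h4⟩ ⟨k1, ⟨N, k2⟩, k3, k4⟩
    exact ⟨h1.add k1, ⟨M + N, fun z hz => (norm_add_le _ _).trans (add_le_add (h2 z hz) (k2 z hz))⟩,
      fun τ => by simp [h3, k3], fun τ => by simp [h4, k4]⟩
  smul_mem' := by
    rintro c F ⟨h1, ⟨M, h2⟩, h3, h4⟩
    exact ⟨h1.const_smul c, ⟨‖c‖ * M, fun z hz => (norm_smul_le _ _).trans
      (mul_le_mul_of_nonneg_left (h2 z hz) (norm_nonneg c))⟩,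
      fun τ => by simp [h3], fun τ => by simp [h4]⟩

/-- The norm `max (sup ‖F(iτ)‖_{X₀}) (sup ‖F(1 + iτ)‖_{X₁})` of an admissible function. -/
noncomputable def admissibleNorm (G : A.Admissible) : ℝ := max ‖G.1.2.1‖ ‖G.1.2.2‖

/-- The value `F(θ)` of an admissible function, as an element of `E`. -/
noncomputable def evalAt (θ : ℝ) : A.Admissible →ₗ[ℂ] E where
  toFun G := A.sum.incl (G.1.1 θ)
  map_add' F G := by simp
  map_smul' c F := by simp

/-- The norm `inf {‖F‖ : F admissible, F(θ) = f}` of the complex method. -/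
noncomputable def complexNorm (θ : ℝ) (f : E) : ℝ :=
  ⨅ G : {G : A.Admissible // A.evalAt θ G = f}, A.admissibleNorm G.1

theorem admissibleNorm_nonneg (G : A.Admissible) : 0 ≤ A.admissibleNorm G :=
  le_max_of_le_left (norm_nonneg _)

theorem complexNorm_le (θ : ℝ) (G : A.Admissible) :
    A.complexNorm θ (A.evalAt θ G) ≤ A.admissibleNorm G :=
  ciInf_le (f := fun H : {H : A.Admissible // A.evalAt θ H = A.evalAt θ G} =>
    A.admissibleNorm H.1) ⟨0, by rintro _ ⟨H, rfl⟩; exact A.admissibleNorm_nonneg _⟩ ⟨G, rfl⟩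

theorem nonempty_admissible {θ : ℝ} {f : E} (hf : f ∈ LinearMap.range (A.evalAt θ)) :
    Nonempty {G : A.Admissible // A.evalAt θ G = f} := by
  obtain ⟨G, rfl⟩ := hf
  exact ⟨⟨G, rfl⟩⟩

theorem complexNorm_add_le {θ : ℝ} {f g : E} (hf : f ∈ LinearMap.range (A.evalAt θ))
    (hg : g ∈ LinearMap.range (A.evalAt θ)) :
    A.complexNorm θ (f + g) ≤ A.complexNorm θ f + A.complexNorm θ g := by
  have := A.nonempty_admissible hf
  have := A.nonempty_admissible hg
  refine le_ciInf_add_ciInf fun F G => ?_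
  have h := A.complexNorm_le θ (F.1 + G.1)
  rw [map_add, F.2, G.2] at h
  exact h.trans (max_le
    ((norm_add_le _ _).trans (add_le_add (le_max_left _ _) (le_max_left _ _)))
    ((norm_add_le _ _).trans (add_le_add (le_max_right _ _) (le_max_right _ _))))

theorem complexNorm_smul_le {θ : ℝ} (c : ℂ) {f : E} (hf : f ∈ LinearMap.range (A.evalAt θ)) :
    A.complexNorm θ (c • f) ≤ ‖c‖ * A.complexNorm θ f := by
  have := A.nonempty_admissible hf
  rw [complexNorm.eq_1 A θ f, Real.mul_iInf_of_nonneg (norm_nonneg c)]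
  refine le_ciInf fun F => ?_
  have h := A.complexNorm_le θ (c • F.1)
  rw [map_smul, F.2] at h
  refine h.trans (max_le ?_ ?_)
  · exact (norm_smul_le c F.1.1.2.1).trans
      (mul_le_mul_of_nonneg_left (le_max_left _ _) (norm_nonneg c))
  · exact (norm_smul_le c F.1.1.2.2).trans
      (mul_le_mul_of_nonneg_left (le_max_right _ _) (norm_nonneg c))

theorem norm_sum_incl_eq {f : A.X₀.Space} {g : A.sum.Space} (h : A.sum.incl g = A.X₀.incl f) :
    ‖g‖ ≤ ‖f‖ := by
  have : ‖g‖ = A.K 1 (A.sum.incl g) := rfl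
  rw [this, K]
  refine (ciInf_le (A.K_bddBelow zero_le_one _) ⟨(f, 0), by simp [h]⟩).trans ?_
  simp

theorem norm_sum_incl_eq' {f : A.X₁.Space} {g : A.sum.Space}
    (h : A.sum.incl g = A.X₁.incl f) : ‖g‖ ≤ ‖f‖ := by
  have : ‖g‖ = A.K 1 (A.sum.incl g) := rfl
  rw [this, K]
  refine (ciInf_le (A.K_bddBelow zero_le_one _) ⟨(0, f), by simp [h]⟩).trans ?_
  simp

theorem norm_le_admissibleNorm (G : A.Admissible) {z : ℂ} (h0 : 0 ≤ z.re) (h1 : z.re ≤ 1) :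
    ‖G.1.1 z‖ ≤ A.admissibleNorm G := by
  obtain ⟨hd, ⟨M, hM⟩, hl, hr⟩ := G.2
  refine PhragmenLindelof.vertical_strip (a := 0) (b := 1) hd ?_ ?_ ?_ h0 h1
  · refine ⟨0, by simpa using Real.pi_pos, 0, Asymptotics.IsBigO.of_bound M ?_⟩
    filter_upwards [mem_inf_of_right (mem_principal_self _)] with z hz
    simpa using hM z ⟨le_of_lt hz.1, le_of_lt hz.2⟩
  · intro z hz
    have hz' : z = (z.im : ℂ) * Complex.I := by apply Complex.ext <;> simp [hz]
    have hl' := hl z.im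
    rw [← hz'] at hl'
    exact (A.norm_sum_incl_eq hl').trans ((G.1.2.1.norm_coe_le_norm _).trans (le_max_left _ _))
  · intro z hz
    have hz' : z = 1 + (z.im : ℂ) * Complex.I := by apply Complex.ext <;> simp [hz]
    have hr' := hr z.im
    rw [← hz'] at hr'
    exact (A.norm_sum_incl_eq' hr').trans
      ((G.1.2.2.norm_coe_le_norm _).trans (le_max_right _ _))

theorem eq_zero_of_complexNorm_eq_zero {θ : ℝ} (hθ : θ ∈ Ioo (0 : ℝ) 1) {f : E}
    (hf : f ∈ LinearMap.range (A.evalAt θ)) (h : A.complexNorm θ f = 0) : f = 0 := by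
  have := A.nonempty_admissible hf
  have hs : f ∈ A.sum.toSubmodule := by
    obtain ⟨G, rfl⟩ := hf
    exact A.sum.incl_mem _
  have hle : ‖A.sum.elt f hs‖ ≤ A.complexNorm θ f := by
    refine le_ciInf fun G => ?_
    have h1 : A.sum.elt f hs = G.1.1.1 θ := A.sum.incl_injective G.2.symm
    rw [h1]
    exact A.norm_le_admissibleNorm G.1 (by simpa using hθ.1.le) (by simpa using hθ.2.le)
  rw [h] at hle
  have h2 : A.sum.elt f hs = 0 := norm_le_zero_iff.1 hle
  simpa [h2] using (A.sum.incl_elt f hs).symm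

/-- The complex interpolation space `[X₀, X₁]_θ`: the values `F(θ)` of the admissible
functions. -/
noncomputable def complexInterp (θ : ℝ) (hθ : θ ∈ Ioo (0 : ℝ) 1) : NormedSubspace E where
  toSubmodule := LinearMap.range (A.evalAt θ)
  seminorm := Seminorm.ofSMulLE (fun f => A.complexNorm θ f)
    (le_antisymm
      (by simpa using A.complexNorm_smul_le (θ := θ) 0 (Submodule.zero_mem _))
      (Real.iInf_nonneg fun G => A.admissibleNorm_nonneg G.1))
    (fun f g => A.complexNorm_add_le f.2 g.2)
    (fun c f => A.complexNorm_smul_le c f.2)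
  eq_zero_of_seminorm_eq_zero := fun f hf =>
    Subtype.ext (A.eq_zero_of_complexNorm_eq_zero hθ f.2 hf)

end InterpolationCouple

/-! ### Homogeneous Banach spaces on the circle -/

/-- The circle `ℝ / 2πℤ`. -/
abbrev Torus : Type := AddCircle (2 * π)

instance factTwoPiPos : Fact (0 < 2 * π) := ⟨Real.two_pi_pos⟩

/-- `L¹(𝕋)`; the measure is `ds / 2π`, so that `‖f‖ = (1 / 2π) ∫ |f(s)| ds`. -/
abbrev L1Torus : Type := Lp ℂ 1 (AddCircle.haarAddCircle : Measure Torus)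

/-- The translation `f ↦ f(· + a)`. -/
noncomputable def translation (a : Torus) : L1Torus →ₗᵢ[ℂ] L1Torus :=
  Lp.compMeasurePreservingₗᵢ ℂ (fun s : Torus => s + a)
    (measurePreserving_add_right AddCircle.haarAddCircle a)

namespace NormedSubspace

/-- `X ⊆ L¹(𝕋)` is a homogeneous Banach space. -/
structure IsHomogeneous (X : NormedSubspace L1Torus) : Prop where
  complete : CompleteSpace X.Space
  norm_L1_le : ∀ f : X.Space, ‖X.incl f‖ ≤ ‖f‖
  translate_mem : ∀ (a : Torus), ∀ f ∈ X.toSubmodule, translation a f ∈ X.toSubmodule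
  norm_translate : ∀ (a : Torus) (f : L1Torus) (hf : f ∈ X.toSubmodule),
    ‖X.elt (translation a f) (translate_mem a f hf)‖ = ‖X.elt f hf‖
  tendsto_translate : ∀ (a : Torus) (f : L1Torus) (hf : f ∈ X.toSubmodule),
    Tendsto (fun b : Torus => ‖X.elt (translation b f) (translate_mem b f hf)
      - X.elt (translation a f) (translate_mem a f hf)‖) (𝓝 a) (𝓝 0)

/-- `X` becomes a homogeneous Banach space if its norm is replaced by an equivalent one. -/
def IsHomogeneousUpToEquiv (X : NormedSubspace L1Torus) : Prop :=
  ∃ Y : NormedSubspace L1Torus, X.EquivNorm Y ∧ Y.IsHomogeneous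

/-- Two homogeneous Banach spaces form an interpolation couple. -/
def IsHomogeneous.couple {X₀ X₁ : NormedSubspace L1Torus} (h₀ : X₀.IsHomogeneous)
    (h₁ : X₁.IsHomogeneous) : InterpolationCouple L1Torus where
  X₀ := X₀
  X₁ := X₁
  complete₀ := h₀.complete
  complete₁ := h₁.complete
  continuous₀ := AddMonoidHomClass.continuous_of_bound X₀.incl 1
    fun f => by simpa using h₀.norm_L1_le f
  continuous₁ := AddMonoidHomClass.continuous_of_bound X₁.incl 1
    fun f => by simpa using h₁.norm_L1_le f

end NormedSubspace

/-! Translations act isometrically on both endpoint spaces, hence contractively on every norm built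
functorially from them; applying this to the inverse translation turns contraction into isometry. A
bound of the `L¹` norm by a constant times the interpolation norm suffices for (H₁), because
multiplying the norm by that constant is an allowed change of norm.
`isHomogeneousUpToEquiv_of_bound` packages these reductions and leaves completeness, the `L¹` bound,
contractivity, and continuity of translation.

Real method. The bound `min(1,t) K(1,f) ≤ K(t,f)` embeds the space in `X₀ + X₁`, which is complete
as a quotient of `X₀ × X₁`; Fatou's lemma then carries completeness over. For (H₃), splitting `f =
f₀ + f₁` shows that `K(t, f(·+b) - f(·+a)) → 0` for each fixed `t`. This quantity is at most `2
K(t,f)`, so dominated convergence applies; this is where `q < ∞` is needed.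

Complex method. Absolutely convergent series lift to admissible functions, which can be summed by
the three lines bound and the Weierstrass theorem. For (H₃), translate an admissible `F` with `F(θ)
= f` pointwise. Strong continuity need not be uniform along an unbounded boundary line, so `F` is
first multiplied by `exp(z² - θ²)`: the value at `θ` is unchanged and the boundary functions now
vanish at infinity. Compactness then makes the convergence uniform
(`tendsto_norm_translateBCF_sub`). -/

theorem translation_neg_translation (a : Torus) (f : L1Torus) :
    translation (-a) (translation a f) = f := by
  refine Lp.ext ?_
  have hm := measurePreserving_add_right (AddCircle.haarAddCircle : Measure Torus) (-a)
  have h1 : translation (-a) (translation a f) =ᵐ[AddCircle.haarAddCircle]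
      translation a f ∘ (fun s : Torus => s + -a) := Lp.coeFn_compMeasurePreserving _ hm
  have h2 : translation a f =ᵐ[AddCircle.haarAddCircle] f ∘ (fun s : Torus => s + a) :=
    Lp.coeFn_compMeasurePreserving _ (measurePreserving_add_right AddCircle.haarAddCircle a)
  filter_upwards [h1, hm.quasiMeasurePreserving.ae_eq_comp h2] with s e1 e2
  rw [e1, e2]
  simp

theorem completeSpace_of_summable_norm {V : Type*} [NormedAddCommGroup V]
    (h : ∀ u : ℕ → V, Summable (fun n => ‖u n‖) → Summable u) : CompleteSpace V :=
  NormedAddCommGroup.completeSpace_of_summable_imp_tendsto fun u hu =>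
    ⟨_, (h u hu).hasSum.tendsto_sum_nat⟩

/-! ### Rescaled norms and a criterion for homogeneity -/

namespace NormedSubspace

section Scale

variable {E : Type*} [NormedAddCommGroup E] [NormedSpace ℂ E]

theorem norm_elt_congr (X : NormedSubspace E) {f g : E} (h : f = g) (hf : f ∈ X.toSubmodule)
    (hg : g ∈ X.toSubmodule) : ‖X.elt f hf‖ = ‖X.elt g hg‖ := by
  subst h; rfl

/-- The same space with its norm multiplied by a positive constant. -/
noncomputable def scale (X : NormedSubspace E) (c : ℝ) (hc : 0 < c) : NormedSubspace E where
  toSubmodule := X.toSubmodule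
  seminorm := Seminorm.of (fun f => c * X.seminorm f)
    (fun f g => by rw [← mul_add]; exact mul_le_mul_of_nonneg_left (map_add_le_add _ f g) hc.le)
    (fun a f => by rw [map_smul_eq_mul]; ring)
  eq_zero_of_seminorm_eq_zero := fun f hf =>
    X.eq_zero_of_seminorm_eq_zero f ((mul_eq_zero.1 hf).resolve_left hc.ne')

variable (X : NormedSubspace E) {c : ℝ} (hc : 0 < c)

theorem norm_scale_elt (f : E) (hf : f ∈ X.toSubmodule) :
    ‖(X.scale c hc).elt f hf‖ = c * ‖X.elt f hf‖ := rfl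

theorem equivNorm_scale : X.EquivNorm (X.scale c hc) :=
  ⟨rfl, c, c, hc, hc, fun f hX _ =>
    ⟨(X.norm_scale_elt hc f hX).ge, (X.norm_scale_elt hc f hX).le⟩⟩

theorem completeSpace_scale (h : CompleteSpace X.Space) : CompleteSpace (X.scale c hc).Space := by
  let φ : X.Space →ₗ[ℂ] (X.scale c hc).Space :=
    { toFun := fun f => f, map_add' := fun _ _ => rfl, map_smul' := fun _ _ => rfl }
  have hφ : ∀ f, ‖φ f‖ = c * ‖f‖ := fun f => rfl
  have hcont : Continuous φ := AddMonoidHomClass.continuous_of_bound φ c fun f => (hφ f).le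
  refine completeSpace_of_summable_norm fun u hu => ?_
  let v : ℕ → X.Space := fun n => u n
  have hv : ∀ n, φ (v n) = u n := fun n => rfl
  have hs : Summable fun n => ‖v n‖ := by
    refine (hu.mul_left c⁻¹).congr fun n => ?_
    rw [← hv n, hφ, inv_mul_cancel_left₀ hc.ne']
  exact ((Summable.of_norm hs).hasSum.map φ hcont).summable

end Scale

variable {X : NormedSubspace L1Torus}

/-- Scaling the norm by `C` absorbs the constant in the `L¹` bound. Contractivity is enough for
(H₂), since translation by `-a` inverts translation by `a`. -/
theorem isHomogeneousUpToEquiv_of_bound {C : ℝ} (hC : 0 < C) (hX : CompleteSpace X.Space)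
    (hL : ∀ (f : L1Torus) (hf : f ∈ X.toSubmodule), ‖f‖ ≤ C * ‖X.elt f hf‖)
    (hmem : ∀ (a : Torus), ∀ f ∈ X.toSubmodule, translation a f ∈ X.toSubmodule)
    (hle : ∀ (a : Torus) (f : L1Torus) (hf : f ∈ X.toSubmodule),
      ‖X.elt (translation a f) (hmem a f hf)‖ ≤ ‖X.elt f hf‖)
    (ht : ∀ (a : Torus) (f : L1Torus) (hf : f ∈ X.toSubmodule),
      Tendsto (fun b : Torus => ‖X.elt (translation b f - translation a f)
        (Submodule.sub_mem _ (hmem b f hf) (hmem a f hf))‖) (𝓝 a) (𝓝 0)) :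
    X.IsHomogeneousUpToEquiv := by
  refine ⟨X.scale C hC, X.equivNorm_scale hC, X.completeSpace_scale hC hX,
    fun f => hL (X.incl f) (X.incl_mem f), hmem, fun a f hf => ?_, fun a f hf => ?_⟩
  · have h : ‖X.elt (translation a f) (hmem a f hf)‖ = ‖X.elt f hf‖ := by
      refine le_antisymm (hle a f hf) ?_
      have h1 := hle (-a) (translation a f) (hmem a f hf)
      rwa [X.norm_elt_congr (translation_neg_translation a f) _ hf] at h1
    exact congrArg (C * ·) h
  · have h := (ht a f hf).const_mul C
    rw [mul_zero] at h
    exact h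

namespace IsHomogeneous

variable (h : X.IsHomogeneous)

/-- The translations act isometrically on a homogeneous Banach space. -/
noncomputable def translate (a : Torus) : X.Space →ₗᵢ[ℂ] X.Space where
  toFun f := X.elt (translation a (X.incl f)) (h.translate_mem a _ (X.incl_mem f))
  map_add' f g := X.incl_injective (by simp [incl_elt])
  map_smul' c f := X.incl_injective (by simp [incl_elt])
  norm_map' f := h.norm_translate a (X.incl f) (X.incl_mem f)

theorem incl_translate (a : Torus) (f : X.Space) :
    X.incl (h.translate a f) = translation a (X.incl f) := rfl

theorem tendsto_norm_translate_sub (a : Torus) (f : X.Space) :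
    Tendsto (fun b => ‖h.translate b f - h.translate a f‖) (𝓝 a) (𝓝 0) :=
  h.tendsto_translate a (X.incl f) (X.incl_mem f)

/-- Strong continuity becomes joint continuity because all translations are 1-Lipschitz. -/
theorem continuous_translate : Continuous fun p : X.Space × Torus => h.translate p.2 p.1 :=
  continuous_prod_of_continuous_lipschitzWith _ 1
    (fun f => continuous_iff_continuousAt.2 fun a =>
      tendsto_iff_norm_sub_tendsto_zero.2 (h.tendsto_norm_translate_sub a f))
    (fun a => (h.translate a).lipschitz)

end IsHomogeneous

end NormedSubspace

/-! ### The sum space and the K-functional -/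

namespace InterpolationCouple

section Sum

variable {E : Type*} [NormedAddCommGroup E] [NormedSpace ℂ E] (A : InterpolationCouple E)

theorem K_le_of_eq {t : ℝ} (ht : 0 ≤ t) {f : E} (f₀ : A.X₀.Space) (f₁ : A.X₁.Space)
    (h : A.X₀.incl f₀ + A.X₁.incl f₁ = f) : A.K t f ≤ ‖f₀‖ + t * ‖f₁‖ :=
  ciInf_le (A.K_bddBelow ht f) ⟨(f₀, f₁), h⟩

theorem add_mem_sum (f₀ : A.X₀.Space) (f₁ : A.X₁.Space) :
    A.X₀.incl f₀ + A.X₁.incl f₁ ∈ A.sum.toSubmodule :=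
  Submodule.add_mem_sup (A.X₀.incl_mem f₀) (A.X₁.incl_mem f₁)

/-- The addition map `X₀ × X₁ → X₀ + X₁`. -/
noncomputable def addMap : A.X₀.Space × A.X₁.Space →ₗ[ℂ] A.sum.Space where
  toFun p := A.sum.elt (A.X₀.incl p.1 + A.X₁.incl p.2) (A.add_mem_sum p.1 p.2)
  map_add' p r := A.sum.incl_injective (by simp [NormedSubspace.incl_elt]; abel)
  map_smul' c p := A.sum.incl_injective (by simp [NormedSubspace.incl_elt])

theorem norm_addMap_le (p : A.X₀.Space × A.X₁.Space) : ‖A.addMap p‖ ≤ ‖p.1‖ + ‖p.2‖ := by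
  refine (A.K_le_of_eq zero_le_one p.1 p.2 rfl).trans_eq ?_
  rw [one_mul]

/-- The factor 2 gives room below which the infimum need not be attained; this needs `‖f‖ > 0`, so
`f = 0` is treated apart. -/
theorem exists_addMap_eq (f : A.sum.Space) :
    ∃ p, A.addMap p = f ∧ ‖p.1‖ + ‖p.2‖ ≤ 2 * ‖f‖ := by
  rcases eq_or_ne f 0 with rfl | hf
  · exact ⟨0, map_zero _, by simp⟩
  have hpos : 0 < ‖f‖ := norm_pos_iff.2 hf
  have := A.nonempty_decomp (A.sum.incl_mem f)
  have hlt : A.K 1 (A.sum.incl f) < 2 * ‖f‖ := by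
    have : ‖f‖ = A.K 1 (A.sum.incl f) := rfl
    linarith
  obtain ⟨⟨p, hp⟩, h⟩ := exists_lt_of_ciInf_lt hlt
  exact ⟨p, A.sum.incl_injective hp, by simpa using h.le⟩

/-- An absolutely convergent series lifts, term by term and with norm control, to one in the Banach
space `X₀ × X₁`; its sum is mapped back by the continuous addition map. -/
theorem completeSpace_sum : CompleteSpace A.sum.Space := by
  have := A.complete₀
  have := A.complete₁
  refine completeSpace_of_summable_norm fun u hu => ?_
  choose p hp hle using fun n => A.exists_addMap_eq (u n)
  have hs : Summable p := by
    refine Summable.of_norm_bounded (hu.mul_left 2) fun n => le_trans ?_ (hle n)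
    exact max_le (le_add_of_nonneg_right (norm_nonneg _)) (le_add_of_nonneg_left (norm_nonneg _))
  have hc : Continuous A.addMap := AddMonoidHomClass.continuous_of_bound A.addMap 2 fun q => by
    have h0 := norm_fst_le q
    have h1 := norm_snd_le q
    linarith [A.norm_addMap_le q]
  refine (hs.hasSum.map A.addMap hc).summable.congr fun n => ?_
  exact hp n

theorem K_le_max_mul {t : ℝ} (ht : 0 ≤ t) {f : E}
    (hf : f ∈ A.X₀.toSubmodule ⊔ A.X₁.toSubmodule) : A.K t f ≤ max 1 t * A.K 1 f := by
  have := A.nonempty_decomp hf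
  rw [K, K, Real.mul_iInf_of_nonneg (by positivity)]
  refine ciInf_mono (A.K_bddBelow ht f) fun p => ?_
  have h0 := mul_le_mul_of_nonneg_right (le_max_left 1 t) (norm_nonneg p.1.1)
  have h1 := mul_le_mul_of_nonneg_right (le_max_right 1 t) (norm_nonneg p.1.2)
  linarith

theorem min_mul_K_le {t : ℝ} (ht : 0 ≤ t) {f : E}
    (hf : f ∈ A.X₀.toSubmodule ⊔ A.X₁.toSubmodule) : min 1 t * A.K 1 f ≤ A.K t f := by
  have := A.nonempty_decomp hf
  have hm : 0 ≤ min 1 t := le_min zero_le_one ht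
  rw [K, K, Real.mul_iInf_of_nonneg hm]
  refine ciInf_mono ⟨0, by rintro _ ⟨p, rfl⟩; positivity⟩ fun p => ?_
  have h0 := mul_le_mul_of_nonneg_right (min_le_left 1 t) (norm_nonneg p.1.1)
  have h1 := mul_le_mul_of_nonneg_right (min_le_right 1 t) (norm_nonneg p.1.2)
  linarith

theorem abs_K_sub_K_le {t : ℝ} (ht : 0 ≤ t) (f g : A.sum.Space) :
    |A.K t (A.sum.incl f) - A.K t (A.sum.incl g)| ≤ A.K t (A.sum.incl (f - g)) := by
  have key : ∀ f g : A.sum.Space,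
      A.K t (A.sum.incl f) - A.K t (A.sum.incl g) ≤ A.K t (A.sum.incl (f - g)) := fun f g => by
    have h := A.K_add_le ht (A.sum.incl_mem (f - g)) (A.sum.incl_mem g)
    rw [← map_add, sub_add_cancel] at h
    linarith
  refine abs_sub_le_iff.2 ⟨key f g, (key g f).trans_eq ?_⟩
  have h := A.K_smul ht (-1) (A.sum.incl_mem (f - g))
  rw [← map_smul, neg_one_smul, neg_sub] at h
  simpa using h

theorem continuous_K {t : ℝ} (ht : 0 ≤ t) :
    Continuous fun f : A.sum.Space => A.K t (A.sum.incl f) := by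
  have hK : (0 : ℝ) ≤ max 1 t := by positivity
  refine (LipschitzWith.of_dist_le_mul (K := ⟨max 1 t, hK⟩) fun f g => ?_).continuous
  rw [Real.dist_eq, dist_eq_norm]
  exact (A.abs_K_sub_K_le ht f g).trans (A.K_le_max_mul ht (A.sum.incl_mem (f - g)))

end Sum

/-! ### Translations and the K-functional -/

section Translation

variable {A : InterpolationCouple L1Torus}

theorem translation_mem_sup (h₀ : A.X₀.IsHomogeneous)
    (h₁ : A.X₁.IsHomogeneous) (a : Torus) {f : L1Torus}
    (hf : f ∈ A.X₀.toSubmodule ⊔ A.X₁.toSubmodule) :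
    translation a f ∈ A.X₀.toSubmodule ⊔ A.X₁.toSubmodule := by
  obtain ⟨⟨p, rfl⟩⟩ := A.nonempty_decomp hf
  rw [map_add]
  exact A.add_mem_sum (h₀.translate a p.1) (h₁.translate a p.2)

theorem K_translation_le (h₀ : A.X₀.IsHomogeneous)
    (h₁ : A.X₁.IsHomogeneous) {t : ℝ} (ht : 0 ≤ t) (a : Torus) {f : L1Torus}
    (hf : f ∈ A.X₀.toSubmodule ⊔ A.X₁.toSubmodule) : A.K t (translation a f) ≤ A.K t f := by
  have := A.nonempty_decomp hf
  refine le_ciInf fun p => ?_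
  refine (A.K_le_of_eq ht (h₀.translate a p.1.1) (h₁.translate a p.1.2) ?_).trans_eq ?_
  · rw [h₀.incl_translate, h₁.incl_translate, ← map_add, p.2]
  · simp

theorem tendsto_K_translation_sub (h₀ : A.X₀.IsHomogeneous)
    (h₁ : A.X₁.IsHomogeneous) {t : ℝ} (ht : 0 ≤ t) (a : Torus) {f : L1Torus}
    (hf : f ∈ A.X₀.toSubmodule ⊔ A.X₁.toSubmodule) :
    Tendsto (fun b => A.K t (translation b f - translation a f)) (𝓝 a) (𝓝 0) := by
  obtain ⟨⟨p, hp⟩⟩ := A.nonempty_decomp hf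
  have h := (h₀.tendsto_norm_translate_sub a p.1).add
    ((h₁.tendsto_norm_translate_sub a p.2).const_mul t)
  rw [mul_zero, add_zero] at h
  refine squeeze_zero (fun b => A.K_nonneg ht _) (fun b => A.K_le_of_eq ht _ _ ?_) h
  rw [map_sub, map_sub, h₀.incl_translate, h₀.incl_translate, h₁.incl_translate,
    h₁.incl_translate, ← hp, map_add, map_add]
  abel

theorem norm_le_K_one (h₀ : A.X₀.IsHomogeneous)
    (h₁ : A.X₁.IsHomogeneous) {f : L1Torus} (hf : f ∈ A.X₀.toSubmodule ⊔ A.X₁.toSubmodule) :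
    ‖f‖ ≤ A.K 1 f := by
  have := A.nonempty_decomp hf
  refine le_ciInf fun p => ?_
  rw [one_mul]
  refine (congrArg norm p.2).ge.trans ?_
  exact (norm_add_le _ _).trans (add_le_add (h₀.norm_L1_le _) (h₁.norm_L1_le _))

end Translation

end InterpolationCouple

/-! ### The real method: embedding and completeness -/

namespace InterpolationCouple

section Real

variable {E : Type*} [NormedAddCommGroup E] [NormedSpace ℂ E] (A : InterpolationCouple E)

/-- Take the `L^q(dt/t)` norm of `t^(-θ) min(1,t) K(1,f) ≤ t^(-θ) K(t,f)`; `C` is the inverse of the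
norm of the weight on the left. -/
theorem exists_K_one_le_realNorm (θ : ℝ) {q : ℝ≥0∞} (hq : 1 ≤ q) :
    ∃ C : ℝ, 0 < C ∧ ∀ f ∈ (A.realInterp θ q hq).toSubmodule,
      A.K 1 f ≤ C * (A.realNorm θ q f).toReal := by
  set φ : ℝ → ℝ := fun t => t ^ (-θ) * min 1 t with hφ
  have hφm : AEStronglyMeasurable φ dtOverT := by
    have : Measurable φ := by fun_prop
    exact this.aestronglyMeasurable
  have hN0 : eLpNorm φ q dtOverT ≠ 0 := by
    intro h
    rw [eLpNorm_eq_zero_iff hφm (zero_lt_one.trans_le hq).ne'] at h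
    have : (ae dtOverT).NeBot := ae_neBot.2 dtOverT_ne_zero
    obtain ⟨t, ht, ht0⟩ := (h.and ae_dtOverT_pos).exists
    have : 0 < φ t := mul_pos (Real.rpow_pos_of_pos ht0 _) (lt_min one_pos ht0)
    exact this.ne' ht
  have key : ∀ f ∈ A.X₀.toSubmodule ⊔ A.X₁.toSubmodule,
      ENNReal.ofReal (A.K 1 f) * eLpNorm φ q dtOverT ≤ A.realNorm θ q f := fun f hf => by
    have hK := A.K_nonneg zero_le_one f
    have h1 : eLpNorm (A.K 1 f • φ) q dtOverT
        = ENNReal.ofReal (A.K 1 f) * eLpNorm φ q dtOverT := by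
      rw [eLpNorm_const_smul, Real.enorm_of_nonneg hK]
    rw [← h1]
    refine eLpNorm_mono_ae_real ?_
    filter_upwards [ae_dtOverT_pos] with t ht
    have h0 : 0 ≤ t ^ (-θ) := Real.rpow_nonneg ht.le _
    have hm : 0 ≤ min 1 t := le_min zero_le_one ht.le
    rw [Pi.smul_apply, smul_eq_mul, Real.norm_of_nonneg (by positivity)]
    calc A.K 1 f * φ t = t ^ (-θ) * (min 1 t * A.K 1 f) := by rw [hφ]; ring
      _ ≤ _ := mul_le_mul_of_nonneg_left (A.min_mul_K_le ht.le hf) h0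
  -- As `θ` is arbitrary here, the weight may have infinite norm; a finite interpolation norm then
  -- forces `K(1,f) = 0`, and any constant serves.
  rcases eq_or_ne (eLpNorm φ q dtOverT) ∞ with hN | hN
  · refine ⟨1, one_pos, fun f hf => ?_⟩
    have h := (key f hf.1).trans_lt hf.2
    rw [hN] at h
    have h0 : ENNReal.ofReal (A.K 1 f) = 0 := by
      by_contra h0
      rw [ENNReal.mul_top h0] at h
      exact h.ne rfl
    rw [one_mul]
    exact (ENNReal.ofReal_eq_zero.1 h0).trans ENNReal.toReal_nonneg
  · have hpos := ENNReal.toReal_pos hN0 hN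
    refine ⟨(eLpNorm φ q dtOverT).toReal⁻¹, inv_pos.2 hpos, fun f hf => ?_⟩
    have h := ENNReal.toReal_mono hf.2.ne (key f hf.1)
    rw [ENNReal.toReal_mul, ENNReal.toReal_ofReal (A.K_nonneg zero_le_one f)] at h
    rw [← div_eq_inv_mul]
    exact (le_div_iff₀ hpos).2 h

/-- The inclusion `(X₀, X₁)_{θ,q} → X₀ + X₁`. -/
noncomputable def realInterpToSum (θ : ℝ) {q : ℝ≥0∞} (hq : 1 ≤ q) :
    (A.realInterp θ q hq).Space →ₗ[ℂ] A.sum.Space where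
  toFun f := A.sum.elt ((A.realInterp θ q hq).incl f) f.2.1
  map_add' _ _ := rfl
  map_smul' _ _ := rfl

theorem continuous_realInterpToSum (θ : ℝ) {q : ℝ≥0∞} (hq : 1 ≤ q) :
    Continuous (A.realInterpToSum θ hq) := by
  obtain ⟨C, -, hC⟩ := A.exists_K_one_le_realNorm θ hq
  exact AddMonoidHomClass.continuous_of_bound _ C fun f => hC _ f.2

/-- Fatou's lemma: `K(t,·)` is continuous on `X₀ + X₁`, so the integrands converge for every `t >
0`. -/
theorem realNorm_le_of_tendsto (θ : ℝ) (q : ℝ≥0∞) {u : ℕ → A.sum.Space} {g : A.sum.Space}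
    (hu : Tendsto u atTop (𝓝 g)) {ε : ℝ≥0∞}
    (h : ∀ᶠ n in atTop, A.realNorm θ q (A.sum.incl (u n)) ≤ ε) :
    A.realNorm θ q (A.sum.incl g) ≤ ε := by
  refine (Lp.eLpNorm_lim_le_liminf_eLpNorm
    (fun n => A.aestronglyMeasurable_K θ (A.sum.incl_mem (u n))) _ ?_).trans
    (liminf_le_of_frequently_le' h.frequently)
  filter_upwards [ae_dtOverT_pos] with t ht
  exact (((A.continuous_K ht.le).tendsto g).comp hu).const_mul _

/-- A Cauchy sequence has a limit `g` in `X₀ + X₁`. Letting `m → ∞` in the bound for `u m - u n`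
gives the same bound for `g - u n`, hence both membership of `g` and convergence in the stronger
norm. -/
theorem completeSpace_realInterp (θ : ℝ) {q : ℝ≥0∞} (hq : 1 ≤ q) :
    CompleteSpace (A.realInterp θ q hq).Space := by
  have := A.completeSpace_sum
  refine Metric.complete_of_cauchySeq_tendsto fun u hu => ?_
  set J := A.realInterpToSum θ hq with hJ
  obtain ⟨g, hg⟩ := cauchySeq_tendsto_of_complete
    ((uniformContinuous_addMonoidHom_of_continuous
      (A.continuous_realInterpToSum θ hq)).comp_cauchySeq hu)
  have key : ∀ ε : ℝ, 0 < ε → ∃ N, ∀ n ≥ N,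
      A.realNorm θ q (A.sum.incl (g - J (u n))) ≤ ENNReal.ofReal ε := fun ε hε => by
    obtain ⟨N, hN⟩ := Metric.cauchySeq_iff.1 hu ε hε
    refine ⟨N, fun n hn => A.realNorm_le_of_tendsto θ q (hg.sub_const (J (u n))) ?_⟩
    filter_upwards [eventually_ge_atTop N] with m hm
    have h1 := hN m hm n hn
    rw [dist_eq_norm] at h1
    have h2 : ‖u m - u n‖ = (A.realNorm θ q (A.sum.incl (J (u m) - J (u n)))).toReal := rfl
    rw [h2] at h1
    exact (ENNReal.le_ofReal_iff_toReal_le (u m - u n).2.2.ne hε.le).2 h1.le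
  have hmem : A.sum.incl g ∈ (A.realInterp θ q hq).toSubmodule := by
    obtain ⟨N, hN⟩ := key 1 one_pos
    have h1 : A.sum.incl (g - J (u N)) ∈ (A.realInterp θ q hq).toSubmodule :=
      ⟨A.sum.incl_mem _, (hN N le_rfl).trans_lt ENNReal.ofReal_lt_top⟩
    have h2 := Submodule.add_mem _ h1 (u N).2
    have h3 : A.sum.incl (g - J (u N)) + (A.realInterp θ q hq).incl (u N) = A.sum.incl g := by
      have : (A.realInterp θ q hq).incl (u N) = A.sum.incl (J (u N)) := rfl
      rw [this, ← map_add, sub_add_cancel]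
    rw [← h3]
    exact h2
  refine ⟨(A.realInterp θ q hq).elt _ hmem, Metric.tendsto_atTop.2 fun ε hε => ?_⟩
  obtain ⟨N, hN⟩ := key (ε / 2) (half_pos hε)
  refine ⟨N, fun n hn => ?_⟩
  rw [dist_comm, dist_eq_norm]
  have h1 : ‖(A.realInterp θ q hq).elt _ hmem - u n‖
      = (A.realNorm θ q (A.sum.incl (g - J (u n)))).toReal := rfl
  rw [h1]
  have h2 := ENNReal.toReal_mono ENNReal.ofReal_ne_top (hN n hn)
  rw [ENNReal.toReal_ofReal (half_pos hε).le] at h2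
  linarith

end Real

/-! ### The real method: continuity of translation -/

section RealTranslation

variable {A : InterpolationCouple L1Torus}

theorem realNorm_translation_le (h₀ : A.X₀.IsHomogeneous) (h₁ : A.X₁.IsHomogeneous) (θ : ℝ)
    (q : ℝ≥0∞) (a : Torus) {f : L1Torus} (hf : f ∈ A.X₀.toSubmodule ⊔ A.X₁.toSubmodule) :
    A.realNorm θ q (translation a f) ≤ A.realNorm θ q f := by
  refine eLpNorm_mono_ae_real ?_
  filter_upwards [ae_dtOverT_pos] with t ht
  have h0 : 0 ≤ t ^ (-θ) := Real.rpow_nonneg ht.le _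
  rw [Real.norm_of_nonneg (mul_nonneg h0 (A.K_nonneg ht.le _))]
  exact mul_le_mul_of_nonneg_left (K_translation_le h₀ h₁ ht.le a hf) h0

theorem tendsto_realNorm_translation_sub (h₀ : A.X₀.IsHomogeneous) (h₁ : A.X₁.IsHomogeneous)
    (θ : ℝ) {q : ℝ≥0∞} (hq : 1 ≤ q) (hq' : q < ∞) (a : Torus) {f : L1Torus}
    (hf : f ∈ (A.realInterp θ q hq).toSubmodule) :
    Tendsto (fun b => A.realNorm θ q (translation b f - translation a f)) (𝓝 a) (𝓝 0) := by
  have hq0 : q ≠ 0 := (zero_lt_one.trans_le hq).ne'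
  have hqr : 0 < q.toReal := ENNReal.toReal_pos hq0 hq'.ne
  have hsub : ∀ b, translation b f - translation a f ∈ A.X₀.toSubmodule ⊔ A.X₁.toSubmodule :=
    fun b => Submodule.sub_mem _ (translation_mem_sup h₀ h₁ b hf.1)
      (translation_mem_sup h₀ h₁ a hf.1)
  have hbound : ∀ b, ∀ t : ℝ, 0 < t →
      A.K t (translation b f - translation a f) ≤ 2 * A.K t f := fun b t ht => by
    have h1 := A.K_add_le ht.le (translation_mem_sup h₀ h₁ b hf.1)
      (Submodule.smul_mem _ (-1) (translation_mem_sup h₀ h₁ a hf.1))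
    rw [A.K_smul ht.le _ (translation_mem_sup h₀ h₁ a hf.1), neg_one_smul, ← sub_eq_add_neg,
      norm_neg, norm_one, one_mul] at h1
    linarith [K_translation_le h₀ h₁ ht.le a hf.1, K_translation_le h₀ h₁ ht.le b hf.1]
  have hlim : Tendsto (fun b => ∫⁻ t, ‖t ^ (-θ) * A.K t (translation b f - translation a f)‖ₑ
      ^ q.toReal ∂dtOverT) (𝓝 a) (𝓝 (∫⁻ _, 0 ∂dtOverT)) := by
    -- The majorant `(2 t^(-θ) K(t,f))^q` does not depend on `b`, and it is integrable because `f`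
    -- has finite norm.
    refine tendsto_lintegral_filter_of_dominated_convergence'
      (fun t => ‖(2 : ℝ) * (t ^ (-θ) * A.K t f)‖ₑ ^ q.toReal) (.of_forall fun b =>
        (A.aestronglyMeasurable_K θ (hsub b)).enorm.pow_const _) (.of_forall fun b => ?_) ?_ ?_
    · filter_upwards [ae_dtOverT_pos] with t ht
      have h0 : 0 ≤ t ^ (-θ) := Real.rpow_nonneg ht.le _
      refine ENNReal.rpow_le_rpow ?_ hqr.le
      rw [Real.enorm_of_nonneg (mul_nonneg h0 (A.K_nonneg ht.le _)), Real.enorm_of_nonneg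
        (mul_nonneg zero_le_two (mul_nonneg h0 (A.K_nonneg ht.le _)))]
      refine ENNReal.ofReal_le_ofReal ?_
      linarith [mul_le_mul_of_nonneg_left (hbound b t ht) h0]
    · have h : eLpNorm ((2 : ℝ) • fun t : ℝ => t ^ (-θ) * A.K t f) q dtOverT < ∞ := by
        rw [eLpNorm_const_smul]
        exact ENNReal.mul_lt_top enorm_lt_top hf.2
      exact (lintegral_rpow_enorm_lt_top_of_eLpNorm_lt_top hq0 hq'.ne h).ne
    · filter_upwards [ae_dtOverT_pos] with t ht
      have h := (tendsto_K_translation_sub h₀ h₁ ht.le a hf.1).const_mul (t ^ (-θ))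
      rw [mul_zero] at h
      have h2 := h.enorm.ennrpow_const q.toReal
      rwa [enorm_zero, ENNReal.zero_rpow_of_pos hqr] at h2
  rw [lintegral_zero] at hlim
  have h := hlim.ennrpow_const (1 / q.toReal)
  rw [ENNReal.zero_rpow_of_pos (by positivity)] at h
  refine h.congr fun b => ?_
  rw [realNorm, eLpNorm_eq_lintegral_rpow_enorm_toReal hq0 hq'.ne]

theorem isHomogeneousUpToEquiv_realInterp (h₀ : A.X₀.IsHomogeneous) (h₁ : A.X₁.IsHomogeneous)
    (θ : ℝ) {q : ℝ≥0∞} (hq : 1 ≤ q) (hq' : q < ∞) :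
    (A.realInterp θ q hq).IsHomogeneousUpToEquiv := by
  obtain ⟨C, hC, hK⟩ := A.exists_K_one_le_realNorm θ hq
  refine NormedSubspace.isHomogeneousUpToEquiv_of_bound hC (A.completeSpace_realInterp θ hq)
    (fun f hf => (norm_le_K_one h₀ h₁ hf.1).trans (hK f hf))
    (fun a f hf => ⟨translation_mem_sup h₀ h₁ a hf.1,
      (realNorm_translation_le h₀ h₁ θ q a hf.1).trans_lt hf.2⟩)
    (fun a f hf => ENNReal.toReal_mono hf.2.ne (realNorm_translation_le h₀ h₁ θ q a hf.1))
    fun a f hf => ?_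
  exact (ENNReal.tendsto_toReal ENNReal.zero_ne_top).comp
    (tendsto_realNorm_translation_sub h₀ h₁ θ hq hq' a hf)

end RealTranslation

end InterpolationCouple

/-! ### Translating boundary functions -/

namespace NormedSubspace.IsHomogeneous

variable {X : NormedSubspace L1Torus} (h : X.IsHomogeneous) {ι : Type*} [TopologicalSpace ι]

/-- The pointwise translation of a bounded continuous function with values in `X`. -/
noncomputable def translateBCF (a : Torus) (g : ι →ᵇ X.Space) : ι →ᵇ X.Space :=
  BoundedContinuousFunction.comp _ (h.translate a).lipschitz g

theorem translateBCF_apply (a : Torus) (g : ι →ᵇ X.Space) (τ : ι) :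
    h.translateBCF a g τ = h.translate a (g τ) := rfl

theorem norm_translateBCF_le (a : Torus) (g : ι →ᵇ X.Space) : ‖h.translateBCF a g‖ ≤ ‖g‖ :=
  (BoundedContinuousFunction.norm_le (norm_nonneg _)).2 fun τ => by
    rw [translateBCF_apply, LinearIsometry.norm_map]
    exact g.norm_coe_le_norm τ

/-- Decay makes the convergence uniform: off a compact set both translates have norm below `ε/4`,
and on the compact set joint continuity applies. -/
theorem tendsto_norm_translateBCF_sub (a : Torus) {g : ι →ᵇ X.Space}
    (hg : Tendsto (fun τ => ‖g τ‖) (cocompact ι) (𝓝 0)) :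
    Tendsto (fun b => ‖h.translateBCF b g - h.translateBCF a g‖) (𝓝 a) (𝓝 0) := by
  refine Metric.tendsto_nhds.2 fun ε hε => ?_
  obtain ⟨K, hK, hKg⟩ := mem_cocompact.1 (hg.eventually_lt_const (show 0 < ε / 4 by positivity))
  have hc : Continuous fun p : Torus × ι =>
      ‖h.translate p.1 (g p.2) - h.translate a (g p.2)‖ := by
    have h1 := h.continuous_translate.comp
      ((g.continuous.comp continuous_snd).prodMk continuous_fst : Continuous
        fun p : Torus × ι => (g p.2, p.1))
    exact (h1.sub ((h.translate a).continuous.comp (g.continuous.comp continuous_snd))).norm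
  have hev : ∀ᶠ b in 𝓝 a, ∀ τ ∈ K, ‖h.translate b (g τ) - h.translate a (g τ)‖ < ε / 2 := by
    -- The difference vanishes at `(a, τ)`, so it stays below `ε/2` nearby; compactness of `K`
    -- yields one neighbourhood of `a` for all `τ ∈ K`.
    refine hK.eventually_forall_of_forall_eventually fun τ _ => ?_
    refine hc.continuousAt.eventually_lt_const ?_
    simpa using hε
  filter_upwards [hev] with b hb
  rw [Real.dist_0_eq_abs, abs_norm]
  refine lt_of_le_of_lt ?_ (half_lt_self hε)
  refine (BoundedContinuousFunction.norm_le (half_pos hε).le).2 fun τ => ?_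
  rw [BoundedContinuousFunction.sub_apply, translateBCF_apply, translateBCF_apply]
  by_cases hτ : τ ∈ K
  · exact (hb τ hτ).le
  · have h1 : ‖g τ‖ < ε / 4 := hKg hτ
    have h2 := norm_sub_le (h.translate b (g τ)) (h.translate a (g τ))
    rw [LinearIsometry.norm_map, LinearIsometry.norm_map] at h2
    linarith

end NormedSubspace.IsHomogeneous

/-! ### The complex method: completeness and decaying representatives -/

namespace InterpolationCouple

section Complex

variable {E : Type*} [NormedAddCommGroup E] [NormedSpace ℂ E] (A : InterpolationCouple E)

theorem continuous_sum_incl : Continuous A.sum.incl := by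
  obtain ⟨C, -, hC⟩ := A.exists_norm_le_K one_pos
  exact AddMonoidHomClass.continuous_of_bound _ C fun f => hC _ (A.sum.incl_mem f)

theorem norm_complexInterp_le {θ : ℝ} (hθ : θ ∈ Ioo (0 : ℝ) 1)
    (f : (A.complexInterp θ hθ).Space) (G : A.Admissible)
    (h : A.evalAt θ G = (A.complexInterp θ hθ).incl f) : ‖f‖ ≤ A.admissibleNorm G := by
  have h1 := A.complexNorm_le θ G
  rw [h] at h1
  exact h1

theorem exists_admissible_norm_le {θ : ℝ} (hθ : θ ∈ Ioo (0 : ℝ) 1)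
    (f : (A.complexInterp θ hθ).Space) : ∃ G : A.Admissible,
      A.evalAt θ G = (A.complexInterp θ hθ).incl f ∧ A.admissibleNorm G ≤ 2 * ‖f‖ := by
  rcases eq_or_ne f 0 with rfl | hf
  · exact ⟨0, by simp, by simp [admissibleNorm]⟩
  have hpos : 0 < ‖f‖ := norm_pos_iff.2 hf
  have := A.nonempty_admissible ((A.complexInterp θ hθ).incl_mem f)
  have hlt : A.complexNorm θ ((A.complexInterp θ hθ).incl f) < 2 * ‖f‖ := by
    have : ‖f‖ = A.complexNorm θ ((A.complexInterp θ hθ).incl f) := rfl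
    linarith
  obtain ⟨⟨G, hG⟩, h⟩ := exists_lt_of_ciInf_lt hlt
  exact ⟨G, hG, h.le⟩

/-- By the three lines bound the boundary norms dominate the functions on the whole strip, so the
series converges uniformly there and its sum is continuous, and holomorphic inside. -/
theorem exists_admissible_tsum {G : ℕ → A.Admissible}
    (hG : Summable fun n => A.admissibleNorm (G n)) :
    ∃ H : A.Admissible, Tendsto (fun s : Finset ℕ => A.admissibleNorm (∑ n ∈ s, G n - H))
      atTop (𝓝 0) := by
  have := A.complete₀
  have := A.complete₁
  have := A.completeSpace_sum
  have hs₀ : Summable fun n => (G n).1.2.1 :=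
    Summable.of_norm_bounded hG fun n => le_max_left _ _
  have hs₁ : Summable fun n => (G n).1.2.2 :=
    Summable.of_norm_bounded hG fun n => le_max_right _ _
  have hle : ∀ n, ∀ z : ℂ, z.re ∈ Icc (0 : ℝ) 1 → ‖(G n).1.1 z‖ ≤ A.admissibleNorm (G n) :=
    fun n z hz => A.norm_le_admissibleNorm (G n) hz.1 hz.2
  have hs : ∀ z : ℂ, z.re ∈ Icc (0 : ℝ) 1 → Summable fun n => (G n).1.1 z :=
    fun z hz => Summable.of_norm_bounded hG fun n => hle n z hz
  have hcl : closure (Complex.re ⁻¹' Ioo (0 : ℝ) 1) = Complex.re ⁻¹' Icc 0 1 := by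
    rw [Complex.closure_preimage_re, closure_Ioo zero_ne_one]
  refine ⟨⟨(fun z => ∑' n, (G n).1.1 z, ∑' n, (G n).1.2.1, ∑' n, (G n).1.2.2),
    ⟨?_, ?_⟩, ⟨∑' n, A.admissibleNorm (G n), fun z hz =>
      tsum_of_norm_bounded hG.hasSum fun n => hle n z hz⟩, fun τ => ?_, fun τ => ?_⟩, ?_⟩
  · exact Complex.differentiableOn_tsum_of_summable_norm hG
      (fun n => (G n).2.1.differentiableOn) (isOpen_Ioo.preimage Complex.continuous_re)
      fun n z hz => hle n z (Ioo_subset_Icc_self hz)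
  · rw [hcl]
    exact continuousOn_tsum (fun n => by rw [← hcl]; exact (G n).2.1.continuousOn) hG hle
  -- The sums in `X₀ + X₁` and in the endpoint space agree, since both are limits in `E` of the same
  -- series.
  · have e1 := (hs (τ * Complex.I) (by simp)).hasSum.map A.sum.incl A.continuous_sum_incl
    have e2 := (hs₀.hasSum.map (BoundedContinuousFunction.evalCLM ℂ τ)
      (ContinuousLinearMap.continuous _)).map A.X₀.incl A.continuous₀
    refine e1.unique (e2.congr_fun ?_)
    exact fun n => (G n).2.2.2.1 τ
  · have e1 := (hs (1 + τ * Complex.I) (by simp)).hasSum.map A.sum.incl A.continuous_sum_incl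
    have e2 := (hs₁.hasSum.map (BoundedContinuousFunction.evalCLM ℂ τ)
      (ContinuousLinearMap.continuous _)).map A.X₁.incl A.continuous₁
    refine e1.unique (e2.congr_fun ?_)
    exact fun n => (G n).2.2.2.2 τ
  · have e₀ := tendsto_iff_norm_sub_tendsto_zero.1 hs₀.hasSum
    have e₁ := tendsto_iff_norm_sub_tendsto_zero.1 hs₁.hasSum
    have e := e₀.max e₁
    rw [max_self] at e
    refine e.congr fun s => ?_
    simp [admissibleNorm, Prod.fst_sum, Prod.snd_sum]

theorem completeSpace_complexInterp {θ : ℝ} (hθ : θ ∈ Ioo (0 : ℝ) 1) :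
    CompleteSpace (A.complexInterp θ hθ).Space := by
  refine completeSpace_of_summable_norm fun u hu => ?_
  choose G hG hle using fun n => A.exists_admissible_norm_le hθ (u n)
  obtain ⟨H, hH⟩ := A.exists_admissible_tsum (G := G)
    (Summable.of_nonneg_of_le (fun n => A.admissibleNorm_nonneg _) hle (hu.mul_left 2))
  refine ⟨(A.complexInterp θ hθ).elt (A.evalAt θ H) ⟨H, rfl⟩,
    tendsto_iff_norm_sub_tendsto_zero.2 ?_⟩
  refine squeeze_zero (fun s => norm_nonneg _) (fun s => ?_) hH
  refine A.norm_complexInterp_le hθ _ _ ?_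
  rw [map_sub, map_sub, map_sum, map_sum, Finset.sum_congr rfl fun n _ => hG n]
  rfl

/-- The entire function `exp (z² - θ²)`, which equals `1` at `θ` and decays rapidly on vertical
strips. -/
noncomputable def gaussianFactor (θ : ℝ) (z : ℂ) : ℂ := Complex.exp (z ^ 2 - (θ : ℂ) ^ 2)

theorem gaussianFactor_self (θ : ℝ) : gaussianFactor θ θ = 1 := by simp [gaussianFactor]

theorem differentiable_gaussianFactor (θ : ℝ) : Differentiable ℂ (gaussianFactor θ) := by
  unfold gaussianFactor
  fun_prop

/-- With `z = x + iy`, the exponent has real part `x² - y² - θ² ≤ 1 - y²`. -/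
theorem norm_gaussianFactor_le (θ : ℝ) {z : ℂ} (hz : z.re ∈ Icc (0 : ℝ) 1) :
    ‖gaussianFactor θ z‖ ≤ Real.exp (1 - ‖z.im‖ ^ 2) := by
  rw [gaussianFactor, Complex.norm_exp, Real.norm_eq_abs, sq_abs]
  refine Real.exp_le_exp.2 ?_
  have h : (z ^ 2 - (θ : ℂ) ^ 2).re = z.re ^ 2 - z.im ^ 2 - θ ^ 2 := by
    simp [pow_two]
  rw [h]
  nlinarith [hz.1, hz.2, sq_nonneg θ]

theorem norm_gaussianFactor_le_exp_one (θ : ℝ) {z : ℂ} (hz : z.re ∈ Icc (0 : ℝ) 1) :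
    ‖gaussianFactor θ z‖ ≤ Real.exp 1 :=
  (norm_gaussianFactor_le θ hz).trans (Real.exp_le_exp.2 (by linarith [sq_nonneg ‖z.im‖]))

theorem tendsto_exp_one_sub_sq :
    Tendsto (fun τ : ℝ => Real.exp (1 - ‖τ‖ ^ 2)) (cocompact ℝ) (𝓝 0) := by
  refine Real.tendsto_exp_atBot.comp (tendsto_atBot_add_const_left _ 1 ?_)
  exact tendsto_neg_atTop_atBot.comp
    ((tendsto_pow_atTop two_ne_zero).comp tendsto_norm_cocompact_atTop)

/-- The product of a bounded continuous function on the line `Re z = x`, `0 ≤ x ≤ 1`, with the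
Gaussian factor. -/
noncomputable def gaussianSMul {V : Type*} [NormedAddCommGroup V] [NormedSpace ℂ V] (θ : ℝ)
    {x : ℝ} (hx : x ∈ Icc (0 : ℝ) 1) (g : ℝ →ᵇ V) : ℝ →ᵇ V :=
  BoundedContinuousFunction.ofNormedAddCommGroup
    (fun τ => gaussianFactor θ (x + τ * Complex.I) • g τ)
    (((differentiable_gaussianFactor θ).continuous.comp (by fun_prop)).smul g.continuous)
    (Real.exp 1 * ‖g‖) fun τ => by
      rw [norm_smul]
      exact mul_le_mul (norm_gaussianFactor_le_exp_one θ (by simpa using hx))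
        (g.norm_coe_le_norm τ) (norm_nonneg _) (Real.exp_pos 1).le

theorem gaussianSMul_apply {V : Type*} [NormedAddCommGroup V] [NormedSpace ℂ V] (θ : ℝ)
    {x : ℝ} (hx : x ∈ Icc (0 : ℝ) 1) (g : ℝ →ᵇ V) (τ : ℝ) :
    gaussianSMul θ hx g τ = gaussianFactor θ (x + τ * Complex.I) • g τ := rfl

theorem tendsto_norm_gaussianSMul {V : Type*} [NormedAddCommGroup V] [NormedSpace ℂ V] (θ : ℝ)
    {x : ℝ} (hx : x ∈ Icc (0 : ℝ) 1) (g : ℝ →ᵇ V) :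
    Tendsto (fun τ => ‖gaussianSMul θ hx g τ‖) (cocompact ℝ) (𝓝 0) := by
  have h := tendsto_exp_one_sub_sq.mul_const ‖g‖
  rw [zero_mul] at h
  refine squeeze_zero (fun τ => norm_nonneg _) (fun τ => ?_) h
  rw [gaussianSMul_apply, norm_smul]
  refine mul_le_mul ?_ (g.norm_coe_le_norm τ) (norm_nonneg _) (Real.exp_pos _).le
  simpa using norm_gaussianFactor_le θ (z := x + τ * Complex.I) (by simpa using hx)

/-- Multiplication by the Gaussian factor gives the decay. No near-optimal norm is required: one
decaying representative is enough to prove continuity of translation. -/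
theorem exists_admissible_tendsto_zero {θ : ℝ} {f : E}
    (hf : f ∈ LinearMap.range (A.evalAt θ)) : ∃ G : A.Admissible, A.evalAt θ G = f ∧
      Tendsto (fun τ => ‖G.1.2.1 τ‖) (cocompact ℝ) (𝓝 0) ∧
      Tendsto (fun τ => ‖G.1.2.2 τ‖) (cocompact ℝ) (𝓝 0) := by
  obtain ⟨G, rfl⟩ := hf
  have hm₀ : (0 : ℝ) ∈ Icc (0 : ℝ) 1 := left_mem_Icc.2 zero_le_one
  have hm₁ : (1 : ℝ) ∈ Icc (0 : ℝ) 1 := right_mem_Icc.2 zero_le_one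
  refine ⟨⟨(fun z => gaussianFactor θ z • G.1.1 z, gaussianSMul θ hm₀ G.1.2.1,
    gaussianSMul θ hm₁ G.1.2.2), (differentiable_gaussianFactor θ).diffContOnCl.smul G.2.1,
    ⟨Real.exp 1 * A.admissibleNorm G, fun z hz => ?_⟩, fun τ => ?_, fun τ => ?_⟩, ?_,
    tendsto_norm_gaussianSMul θ hm₀ _, tendsto_norm_gaussianSMul θ hm₁ _⟩
  · rw [norm_smul]
    exact mul_le_mul (norm_gaussianFactor_le_exp_one θ hz)
      (A.norm_le_admissibleNorm G hz.1 hz.2) (norm_nonneg _) (Real.exp_pos 1).le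
  · rw [gaussianSMul_apply, map_smul, map_smul, G.2.2.2.1 τ, Complex.ofReal_zero, zero_add]
  · rw [gaussianSMul_apply, map_smul, map_smul, G.2.2.2.2 τ, Complex.ofReal_one]
  · change A.sum.incl (gaussianFactor θ θ • G.1.1 θ) = A.sum.incl (G.1.1 θ)
    rw [gaussianFactor_self, one_smul]

end Complex

/-! ### The complex method: translation invariance and continuity -/

section ComplexTranslation

variable {A : InterpolationCouple L1Torus} (h₀ : A.X₀.IsHomogeneous) (h₁ : A.X₁.IsHomogeneous)

/-- The translation on `X₀ + X₁`. -/
noncomputable def sumTranslate (a : Torus) : A.sum.Space →L[ℂ] A.sum.Space :=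
  LinearMap.mkContinuous
    { toFun := fun f => A.sum.elt (translation a (A.sum.incl f))
        (translation_mem_sup h₀ h₁ a (A.sum.incl_mem f))
      map_add' := fun f g => A.sum.incl_injective
        (map_add (translation a) (A.sum.incl f) (A.sum.incl g))
      map_smul' := fun c f => A.sum.incl_injective
        (map_smul (translation a) c (A.sum.incl f)) }
    1 fun f => by
      rw [one_mul]
      exact K_translation_le h₀ h₁ zero_le_one a (A.sum.incl_mem f)

theorem norm_sumTranslate_le (a : Torus) (f : A.sum.Space) : ‖sumTranslate h₀ h₁ a f‖ ≤ ‖f‖ :=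
  K_translation_le h₀ h₁ zero_le_one a (A.sum.incl_mem f)

/-- The pointwise translation of an admissible function. -/
noncomputable def admissibleTranslate (a : Torus) (G : A.Admissible) : A.Admissible :=
  ⟨(fun z => sumTranslate h₀ h₁ a (G.1.1 z), h₀.translateBCF a G.1.2.1,
    h₁.translateBCF a G.1.2.2),
    (sumTranslate h₀ h₁ a).differentiable.comp_diffContOnCl G.2.1,
    G.2.2.1.imp fun _ hM z hz => (norm_sumTranslate_le h₀ h₁ a _).trans (hM z hz),
    fun τ => congrArg (translation a) (G.2.2.2.1 τ),
    fun τ => congrArg (translation a) (G.2.2.2.2 τ)⟩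

theorem admissibleNorm_admissibleTranslate_le (a : Torus) (G : A.Admissible) :
    A.admissibleNorm (admissibleTranslate h₀ h₁ a G) ≤ A.admissibleNorm G :=
  max_le_max (h₀.norm_translateBCF_le a _) (h₁.norm_translateBCF_le a _)

theorem isHomogeneousUpToEquiv_complexInterp (h₀ : A.X₀.IsHomogeneous)
    (h₁ : A.X₁.IsHomogeneous) {θ : ℝ} (hθ : θ ∈ Ioo (0 : ℝ) 1) :
    (A.complexInterp θ hθ).IsHomogeneousUpToEquiv := by
  have hmem : ∀ (a : Torus), ∀ f ∈ (A.complexInterp θ hθ).toSubmodule,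
      translation a f ∈ (A.complexInterp θ hθ).toSubmodule := by
    rintro a _ ⟨G, rfl⟩
    exact ⟨admissibleTranslate h₀ h₁ a G, rfl⟩
  refine NormedSubspace.isHomogeneousUpToEquiv_of_bound one_pos
    (A.completeSpace_complexInterp hθ) (fun f hf => ?_) hmem (fun a f hf => ?_)
    fun a f hf => ?_
  · have := A.nonempty_admissible hf
    rw [one_mul]
    change ‖f‖ ≤ A.complexNorm θ f
    refine le_ciInf fun G => ?_
    have h1 := norm_le_K_one h₀ h₁ (A.sum.incl_mem (G.1.1.1 θ))
    have h2 : A.sum.incl (G.1.1.1 θ) = f := G.2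
    have h3 : ‖G.1.1.1 θ‖ ≤ A.admissibleNorm G.1 :=
      A.norm_le_admissibleNorm G.1 (by simpa using hθ.1.le) (by simpa using hθ.2.le)
    have h4 : ‖A.sum.incl (G.1.1.1 θ)‖ ≤ ‖G.1.1.1 θ‖ := h1
    rw [h2] at h4
    exact h4.trans h3
  · have := A.nonempty_admissible hf
    change _ ≤ A.complexNorm θ f
    refine le_ciInf fun G => ?_
    refine (A.norm_complexInterp_le hθ _ (admissibleTranslate h₀ h₁ a G.1) ?_).trans
      (admissibleNorm_admissibleTranslate_le h₀ h₁ a G.1)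
    exact congrArg (translation a) G.2
  -- The difference of two translates of `G` represents the difference of the translates of `f`, so
  -- its boundary norms, which tend to 0, bound the interpolation norm.
  · obtain ⟨G, rfl, hg₀, hg₁⟩ := A.exists_admissible_tendsto_zero hf
    have e := (h₀.tendsto_norm_translateBCF_sub a hg₀).max
      (h₁.tendsto_norm_translateBCF_sub a hg₁)
    rw [max_self] at e
    refine squeeze_zero (fun b => norm_nonneg _) (fun b => ?_) e
    refine A.norm_complexInterp_le hθ _
      (admissibleTranslate h₀ h₁ b G - admissibleTranslate h₀ h₁ a G) ?_
    rw [map_sub]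
    rfl

end ComplexTranslation

end InterpolationCouple

theorem theorem3 (X₀ X₁ : NormedSubspace L1Torus) (h₀ : X₀.IsHomogeneous)
    (h₁ : X₁.IsHomogeneous) (θ : ℝ) (hθ : θ ∈ Set.Ioo (0 : ℝ) 1) :
    (∀ (q : ℝ≥0∞) (hq : 1 ≤ q), q < ∞ →
      ((h₀.couple h₁).realInterp θ q hq).IsHomogeneousUpToEquiv) ∧
    ((h₀.couple h₁).complexInterp θ hθ).IsHomogeneousUpToEquiv :=
  ⟨fun _ hq hq' => InterpolationCouple.isHomogeneousUpToEquiv_realInterp h₀ h₁ θ hq hq',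
    InterpolationCouple.isHomogeneousUpToEquiv_complexInterp h₀ h₁ hθ⟩
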